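/- Let $p$ be a prime, $ku_*=\mathbb Z_{(p)}[v]$ the coefficient ring of $p$-local connective complex $K$-theory, and put $g_1=p-1$. For $n\ge 1$ let $a_{t,n}=\binom{p^n}{t+1}v^t$, $0\le t\le p^n-1$, be the coefficients of the $[p^n]$-series $[p^n](x)=\sum_t a_{t,n}x^{t+1}$. Let $F=\bigoplus_{i\ge 1}ku_*\,\alpha_i$ be free, and let $ku_*(\mathbb Z_{p^2})$ be the reduced $ku$-homology of the classifying space of $\mathbb Z/p^2$, that is, the $ku_*$-module with generators $e_j$, $j\ge 1$, and relations $\sum_{t=0}^{p^2-1}a_{t,2}\,e_{j-t}=0$ for $j\ge 1$ (where $\alpha_h=0$ and $e_h=0$ for $h\le 0$). Write $c[i,j]=c\,\alpha_i\otimes e_j\in F\otimes_{ku_*}ku_*(\mathbb Z_{p^2})$ for $c\in ku_*$. For $k\ge 2$ let $$\partial_{k+1}\colon F\otimes_{ku_*}ku_*(\mathbb Z_{p^2})\to F\otimes_{ku_*}ku_*(\mathbb Z_{p^2}),\qquad \partial_{k+1}([i,j])=\sum_{t=0}^{p^{k+1}-1}a_{t,k+1}\,[i-t,j],$$ be the only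 nonzero map of the associated two-term complex, and give $c[i,j]$ the filtration $i(p^{k+1}+1)+j(p^k+1)$. **Theorem.** For every $k\ge 2$: (a) there is a unit $u\in ku_*$ with $\partial_{k+1}([1,kg_1+1])=u\,p\,v^{kg_1}[1,1]$; (b) there are a unit $u\in ku_*$ and an element $\mathrm{low}$, a $ku_*$-linear combination of elements $[i,j]$ with $i,j\ge1$ of filtration strictly lower than that of $[p,(pk+1)g_1+1]$, such that $\partial_{k+1}\bigl(p\,[p,(pk+1)g_1+1]+\mathrm{low}\bigr)=u\,v^{(kp+2)g_1}[1,1]$. -/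

import Mathlib

open scoped TensorProduct

noncomputable section

namespace KuToral

instance primeIdeal_isPrime (p : ℕ) [hp : Fact p.Prime] :
    (Ideal.span {(p : ℤ)}).IsPrime :=
  (Ideal.span_singleton_prime (by exact_mod_cast hp.out.ne_zero)).2
    (Nat.prime_iff_prime_int.mp hp.out)

/-- The ring `ℤ_(p)` of integers localized at `p`. -/
def ZLoc (p : ℕ) [Fact p.Prime] : Type := Localization.AtPrime (Ideal.span {(p : ℤ)})

instance (p : ℕ) [Fact p.Prime] : CommRing (ZLoc p) :=
  inferInstanceAs (CommRing (Localization.AtPrime (Ideal.span {(p : ℤ)})))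

instance (p : ℕ) [Fact p.Prime] : IsLocalization.AtPrime (ZLoc p) (Ideal.span {(p : ℤ)}) := by
  have h : Ring.toIntAlgebra (ZLoc p) =
      (inferInstanceAs (Algebra ℤ (Localization.AtPrime (Ideal.span {(p : ℤ)}))) :
        Algebra ℤ (ZLoc p)) := Subsingleton.elim _ _
  rw [h]
  exact (inferInstance : IsLocalization.AtPrime
    (Localization.AtPrime (Ideal.span {(p : ℤ)})) (Ideal.span {(p : ℤ)}))

/-- The coefficient ring `ku_* = ℤ_(p)[v]` of `p`-local connective complex `K`-theory. -/
abbrev Ku (p : ℕ) [Fact p.Prime] : Type := Polynomial (ZLoc p)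

/-- The generator `v` of `ku_2`. -/
def v (p : ℕ) [Fact p.Prime] : Ku p := Polynomial.X

/-- The number `g_i = p ^ i - 1`. -/
def g (p i : ℕ) : ℕ := p ^ i - 1

/-- The coefficient `a_{t,n} = binom(p ^ n, t + 1) v ^ t` of `x ^ (t + 1)` in the
`[p ^ n]`-series. -/
def seriesCoeff (p : ℕ) [Fact p.Prime] (n t : ℕ) : Ku p :=
  ((p ^ n).choose (t + 1) : Ku p) * v p ^ t

/-- The free `ku_*`-module `F` on generators `α_i`, `i ≥ 1`. -/
abbrev F (p : ℕ) [Fact p.Prime] : Type := ℕ+ →₀ Ku p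

/-- The generator `α_h`, with the convention `α_h = 0` for `h ≤ 0`. -/
def alpha (p : ℕ) [Fact p.Prime] (h : ℤ) : F p :=
  if hh : 0 < h then Finsupp.single (h.toNat.toPNat (by omega)) 1 else 0

/-- The `ku_*`-linear endomorphism `α_i ↦ ∑_{t < p ^ n} a_{t,n} α_{i - t}` of `F`. -/
def seriesMap (p : ℕ) [Fact p.Prime] (n : ℕ) : F p →ₗ[Ku p] F p :=
  Finsupp.linearCombination (Ku p) fun i : ℕ+ =>
    ∑ t ∈ Finset.range (p ^ n), seriesCoeff p n t • alpha p ((i : ℤ) - (t : ℤ))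

/-- The reduced `ku`-homology `ku_*(ℤ/p ^ n)` of the classifying space of `ℤ/p ^ n`: generators
`e_j`, `j ≥ 1`, and relations `∑_{t < p ^ n} a_{t,n} e_{j - t} = 0` for `j ≥ 1`
(with `e_h = 0` for `h ≤ 0`). -/
abbrev KuHomology (p : ℕ) [Fact p.Prime] (n : ℕ) : Type :=
  F p ⧸ LinearMap.range (seriesMap p n)

/-- The generator `e_j` of `ku_*(ℤ/p ^ n)`, zero for `j ≤ 0`; `e_1` is the toral class. -/
def e (p : ℕ) [Fact p.Prime] (n : ℕ) (j : ℤ) : KuHomology p n :=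
  (LinearMap.range (seriesMap p n)).mkQ (alpha p j)

/-- The module `F ⊗ ku_*(ℤ/p ^ n)` over `ku_*`. -/
abbrev Term (p : ℕ) [Fact p.Prime] (n : ℕ) : Type := F p ⊗[Ku p] KuHomology p n

/-- The element `[i, j] = α_i ⊗ e_j`. -/
def gen (p : ℕ) [Fact p.Prime] (n : ℕ) (i j : ℤ) : Term p n := alpha p i ⊗ₜ[Ku p] e p n j

/-- The differential `∂_m` of the two-term complex `F ⊗ ku_*(ℤ/p ^ n) → F ⊗ ku_*(ℤ/p ^ n)`,
built from the `[p ^ m]`-series acting on the first factor. -/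
def boundary (p : ℕ) [Fact p.Prime] (n m : ℕ) : Term p n →ₗ[Ku p] Term p n :=
  LinearMap.rTensor (KuHomology p n) (seriesMap p m)

/-- The filtration degree `|c [i, j]| = i (p ^ (k + 1) + 1) + j (p ^ k + 1)`. -/
def filtrationDegree (p k : ℕ) (i j : ℤ) : ℤ :=
  i * ((p : ℤ) ^ (k + 1) + 1) + j * ((p : ℤ) ^ k + 1)

/-- The elements of filtration lower than that of `[a, b]`: the `ku_*`-linear combinations of the
`[i, j]`, `i, j ≥ 1`, whose filtration degree is smaller than that of `[a, b]`. -/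
def lowerTerms (p : ℕ) [Fact p.Prime] (n k : ℕ) (a b : ℤ) : Submodule (Ku p) (Term p n) :=
  Submodule.span (Ku p)
    {x | ∃ i j : ℤ, 1 ≤ i ∧ 1 ≤ j ∧ filtrationDegree p k i j < filtrationDegree p k a b ∧
      x = gen p n i j}

/-- The differential on generators: `∂_m [i, j] = ∑_{t < p ^ m} a_{t,m} [i - t, j]`. -/
theorem boundary_gen (p : ℕ) [Fact p.Prime] (n m : ℕ) (i j : ℤ) (hi : 1 ≤ i) :
    boundary p n m (gen p n i j) =
      ∑ t ∈ Finset.range (p ^ m), seriesCoeff p m t • gen p n (i - t) j := by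
  have h0 : (0 : ℤ) < i := by omega
  have h1 : ((i.toNat : ℕ) : ℤ) = i := Int.toNat_of_nonneg (by omega)
  have h : seriesMap p m (alpha p i) =
      ∑ t ∈ Finset.range (p ^ m), seriesCoeff p m t • alpha p (i - t) := by
    conv_lhs => rw [alpha, dif_pos h0, seriesMap, Finsupp.linearCombination_single, one_smul]
    simp only [Nat.toPNat, PNat.mk_coe, h1]
  rw [boundary, gen, LinearMap.rTensor_tmul, h, TensorProduct.sum_tmul]
  rfl

/-- The defining relations of the second factor: `∑_{t < p ^ n} a_{t,n} e_{j - t} = 0`. -/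
theorem sum_e_eq_zero (p : ℕ) [Fact p.Prime] (n : ℕ) (j : ℤ) (hj : 1 ≤ j) :
    ∑ t ∈ Finset.range (p ^ n), seriesCoeff p n t • e p n (j - t) = 0 := by
  have h0 : (0 : ℤ) < j := by omega
  have h1 : ((j.toNat : ℕ) : ℤ) = j := Int.toNat_of_nonneg (by omega)
  have h : seriesMap p n (alpha p j) =
      ∑ t ∈ Finset.range (p ^ n), seriesCoeff p n t • alpha p (j - t) := by
    conv_lhs => rw [alpha, dif_pos h0, seriesMap, Finsupp.linearCombination_single, one_smul]
    simp only [Nat.toPNat, PNat.mk_coe, h1]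
  have h2 : (LinearMap.range (seriesMap p n)).mkQ (seriesMap p n (alpha p j)) = 0 := by
    simp
  rw [h, map_sum] at h2
  simpa only [map_smul, e] using h2

end KuToral

end

/-!
Write `g = p - 1` and let `x` and `y` lower by one the index of the generators `e_j` and `α_i`.
The differential is `[p ^ (k + 1)](y) / y`, while `[p ^ 2](x) / x` vanishes on the second factor;
multiplying each `e_j` by a power of `v` that moves it to a fixed degree (`degreeSeq`), one may
put `v = 1`. Everything on the second factor then follows from one observation
(`SeriesRelation.three_term`): for the purpose at hand the relation reduces to
`p ^ 2 + p x ^ g + x ^ (p ^ 2 - 1) = 0`, whose Newton polygon has the two branches `p = -x ^ g`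
and `p = -x ^ (p g)`.

On `α_1` the differential is multiplication by `p ^ (k + 1)`, and the first branch gives
`p ^ (k + 1) e_{k g + 1} = (-1) ^ k p e_1` (`pow_smul_eq_neg_one_pow`). This is the first claim.

For the second claim, an element `β`, equal to `α_p` plus lower generators, is mapped by the series
to `p ^ (k + 1) α_p + p ^ k v ^ g α_1` (`exists_seriesMap_two_term`), because its
coefficients in degrees below `p` are divisible by `p ^ (k + 1)`. On the other side there is
`w = p e_J + ⋯`, with `J = (p k + 1) g + 1`, such that `p ^ (k + 1) w = 0` and
`p ^ k w = (-1) ^ k v ^ (J - 1) e_1 + p ^ (k + 1) z` (`exists_torsion_lift`). Here `w` starts with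
`p e_J + e_{J - g}`, that is with `p + x ^ g`, so that only the second branch survives, and
modulo `p ^ (k + 1)` that branch carries `p ^ k e_{J - g} = p ^ k e_{p k g + 1}` to
`(-1) ^ k e_1` (`pow_smul_mem`, `pow_smul_sub_mem`). The differential therefore maps
`β ⊗ w - v ^ g α_1 ⊗ z` to `(-1) ^ k v ^ ((k p + 2) g) α_1 ⊗ e_1`.
-/

namespace KuToral

open scoped Pointwise

/-! ### Binomial coefficients of prime powers -/

theorem pow_dvd_choose_pow {p : ℕ} (hp : p.Prime) (n : ℕ) {s : ℕ} (hs : ¬ p ∣ s) :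
    p ^ n ∣ (p ^ n).choose s := by
  obtain _ | s := s
  · simp at hs
  have h : p ^ n * (p ^ n - 1).choose s = (p ^ n).choose (s + 1) * (s + 1) := by
    have := Nat.add_one_mul_choose_eq (p ^ n - 1) s
    rwa [Nat.sub_add_cancel (Nat.one_le_pow _ _ hp.pos)] at this
  exact (Nat.Coprime.pow_left n ((Nat.Prime.coprime_iff_not_dvd hp).2 hs)).dvd_of_dvd_mul_right
    (Dvd.intro _ h)

/-- The binomial coefficient `binom(p ^ (n + 1), p)` is `p ^ n` times a number congruent to `1`
modulo `p`. -/
theorem exists_choose_pow_succ_self {p : ℕ} (hp : p.Prime) (n : ℕ) :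
    ∃ c : ℤ, (((p ^ (n + 1)).choose p : ℕ) : ℤ) = p ^ n * (1 + p * c) := by
  have : Fact p.Prime := ⟨hp⟩
  have h1 : 1 ≤ p := hp.one_le
  have hpow : p ^ (n + 1) - 1 = (p - 1) + p * (p ^ n - 1) := by
    have : 1 ≤ p ^ n := Nat.one_le_pow _ _ hp.pos
    zify [h1, this, Nat.one_le_pow (n + 1) p hp.pos]
    ring
  have hlt : p - 1 < p := by omega
  have hluc : ((p ^ (n + 1) - 1).choose (p - 1) : ℤ) ≡ 1 [ZMOD p] := by
    have := Choose.choose_modEq_choose_mod_mul_choose_div (p := p) (n := p ^ (n + 1) - 1)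
      (k := p - 1)
    rw [Nat.mod_eq_of_lt hlt, Nat.div_eq_of_lt hlt, hpow, Nat.add_mul_mod_self_left,
      Nat.mod_eq_of_lt hlt] at this
    rw [hpow]
    simpa using this
  obtain ⟨c, hc⟩ := hluc.symm.dvd
  refine ⟨c, ?_⟩
  have h : p ^ (n + 1) * (p ^ (n + 1) - 1).choose (p - 1) = (p ^ (n + 1)).choose p * p := by
    have := Nat.add_one_mul_choose_eq (p ^ (n + 1) - 1) (p - 1)
    rwa [Nat.sub_add_cancel (Nat.one_le_pow _ _ hp.pos), Nat.sub_add_cancel h1] at this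
  have hz : (p : ℤ) ≠ 0 := by exact_mod_cast hp.ne_zero
  apply mul_right_cancel₀ hz
  have h' : (p : ℤ) ^ (n + 1) * ((p ^ (n + 1) - 1).choose (p - 1) : ℕ) =
      ((p ^ (n + 1)).choose p : ℕ) * p := by exact_mod_cast h
  rw [← h', show (((p ^ (n + 1) - 1).choose (p - 1) : ℕ) : ℤ) = 1 + p * c by linarith]
  ring

/-! ### Sequences annihilated by the `[p ^ 2]`-series -/

section Sequences

variable {R A : Type*} [CommRing R] [AddCommGroup A] [Module R A]

/-- The sequence `E` satisfies, in index `j`, the relation defined by the `[p ^ 2]`-series with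
`v` set to `1`. -/
def SeriesRelation (R : Type*) {A : Type*} [CommRing R] [AddCommGroup A] [Module R A]
    (p : ℕ) (E : ℤ → A) (j : ℤ) : Prop :=
  ∑ t ∈ Finset.range (p ^ 2), ((p ^ 2).choose (t + 1) : R) • E (j - t) = 0

/-- The span of the terms of index at most `d` of a sequence. -/
def initialSpan (R : Type*) {A : Type*} [CommRing R] [AddCommGroup A] [Module R A]
    (E : ℤ → A) (d : ℤ) : Submodule R A :=
  Submodule.span R (E '' Set.Iic d)

theorem mem_initialSpan (E : ℤ → A) {j d : ℤ} (h : j ≤ d) : E j ∈ initialSpan R E d :=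
  Submodule.subset_span ⟨j, h, rfl⟩

/-- Only the monomials `p ^ 2`, `p x ^ (p - 1)` and `x ^ (p ^ 2 - 1)` of the series
`[p ^ 2](x) / x` matter, once the multiples by `p ^ (r + 2)` of the later terms, and those by
`p ^ (r + 1)` of the terms beyond `x ^ (p - 1)`, are neglected. -/
theorem SeriesRelation.three_term {p : ℕ} (hp : p.Prime) {E : ℤ → A} {j : ℤ}
    (hrel : SeriesRelation R p E j) (T : Submodule R A) (r : ℕ)
    (h2 : ∀ i < j, (p : R) ^ (r + 2) • E i ∈ T)
    (h1 : ∀ i < j - (p - 1), (p : R) ^ (r + 1) • E i ∈ T) :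
    (p : R) ^ (r + 2) • E j + (p : R) ^ (r + 1) • E (j - (p - 1)) +
      (p : R) ^ r • E (j - (p ^ 2 - 1)) ∈ T := by
  have hp2 : 2 ≤ p := hp.two_le
  have hpp : p < p ^ 2 := by nlinarith
  set a : A := (p : R) ^ (r + 2) • E j
  set b : A := (p : R) ^ (r + 1) • E (j - (p - 1))
  set c : A := (p : R) ^ r • E (j - (p ^ 2 - 1))
  have hsum : ∑ t ∈ Finset.range (p ^ 2),
      ((if t = 0 then a else 0) + (if t = p - 1 then b else 0) +
        (if t = p ^ 2 - 1 then c else 0)) = a + b + c := by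
    simp only [Finset.sum_add_distrib, Finset.sum_ite_eq', Finset.mem_range]
    rw [if_pos (by omega), if_pos (by omega), if_pos (by omega)]
  have hz : ∑ t ∈ Finset.range (p ^ 2),
      (p : R) ^ r • ((p ^ 2).choose (t + 1) : R) • E (j - t) = 0 := by
    rw [← Finset.smul_sum]
    rw [SeriesRelation] at hrel
    rw [hrel, smul_zero]
  have hdiff := congrArg₂ (· - ·) hsum hz
  simp only [sub_zero, ← Finset.sum_sub_distrib] at hdiff
  rw [← hdiff]
  refine Submodule.sum_mem _ fun t ht => ?_
  rw [Finset.mem_range] at ht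
  by_cases ht0 : t = 0
  · subst ht0
    rw [if_pos rfl, if_neg (by omega), if_neg (by omega)]
    have : a - (p : R) ^ r • (((p ^ 2).choose (0 + 1) : ℕ) : R) • E (j - (0 : ℕ)) = 0 := by
      simp only [a, zero_add, Nat.choose_one_right, smul_smul, Nat.cast_zero, sub_zero]
      push_cast
      rw [← pow_add, sub_self]
    rw [add_zero, add_zero, this]
    exact T.zero_mem
  rw [if_neg ht0]
  by_cases ht1 : t = p - 1
  · subst ht1
    rw [if_pos rfl, if_neg (by omega)]
    obtain ⟨m, hm⟩ := exists_choose_pow_succ_self hp 1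
    have hm' : (((p ^ 2).choose (p - 1 + 1) : ℕ) : R) = p * (1 + p * m) := by
      rw [Nat.sub_add_cancel (by omega)]
      have := congrArg (Int.cast : ℤ → R) hm
      push_cast at this
      simpa using this
    have hcast : (((p - 1 : ℕ)) : ℤ) = p - 1 := by
      push_cast [Nat.cast_sub (show 1 ≤ p by omega)]; ring
    have : 0 + b + 0 - (p : R) ^ r • (((p ^ 2).choose (p - 1 + 1) : ℕ) : R) • E (j - (p - 1 : ℕ))
        = (-(m : R)) • (p : R) ^ (r + 2) • E (j - (p - 1)) := by
      rw [hm', hcast]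
      simp only [b]
      module
    rw [this]
    exact T.smul_mem _ (h2 _ (by omega))
  rw [if_neg ht1]
  by_cases ht2 : t = p ^ 2 - 1
  · subst ht2
    rw [if_pos rfl]
    have hcast : (((p ^ 2 - 1 : ℕ)) : ℤ) = p ^ 2 - 1 := by
      push_cast [Nat.cast_sub (show 1 ≤ p ^ 2 by omega)]; ring
    rw [Nat.sub_add_cancel (by omega), Nat.choose_self, hcast]
    have : 0 + 0 + c - (p : R) ^ r • ((1 : ℕ) : R) • E (j - (p ^ 2 - 1)) = 0 := by
      simp [c]
    rw [this]
    exact T.zero_mem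
  rw [if_neg ht2, add_zero, add_zero, zero_sub]
  refine T.neg_mem ?_
  by_cases hd : p ∣ t + 1
  · have hpt : p ∣ (p ^ 2).choose (t + 1) :=
      hp.dvd_choose_pow (by omega) (by omega)
    obtain ⟨m, hm⟩ := hpt
    have htp : p - 1 < t := by
      have := Nat.le_of_dvd (by omega) hd
      omega
    have : (p : R) ^ r • (((p ^ 2).choose (t + 1) : ℕ) : R) • E (j - t)
        = (m : R) • (p : R) ^ (r + 1) • E (j - t) := by
      rw [hm]; push_cast; module
    rw [this]
    exact T.smul_mem _ (h1 _ (by omega))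
  · obtain ⟨m, hm⟩ := pow_dvd_choose_pow hp 2 hd
    have : (p : R) ^ r • (((p ^ 2).choose (t + 1) : ℕ) : R) • E (j - t)
        = (m : R) • (p : R) ^ (r + 2) • E (j - t) := by
      rw [hm]; push_cast; module
    rw [this]
    exact T.smul_mem _ (h2 _ (by omega))

variable {p : ℕ} {E : ℤ → A} {d : ℤ}

/-- On the branch `p = -x ^ (p - 1)` of the Newton polygon, `p ^ r` kills the terms up to index
`(r - 1) (p - 1)`. -/
theorem pow_smul_eq_zero (hp : p.Prime) (hE : ∀ j ≤ 0, E j = 0)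
    (hrel : ∀ j ≤ d, SeriesRelation R p E j) (r : ℕ) :
    ∀ j ≤ d, j ≤ ((r : ℤ) - 1) * (p - 1) → (p : R) ^ r • E j = 0 := by
  have hp2 : (2 : ℤ) ≤ p := by exact_mod_cast hp.two_le
  induction r using Nat.strong_induction_on with
  | _ r ih =>
  suffices H : ∀ n : ℕ, ∀ j ≤ d, j ≤ n → j ≤ ((r : ℤ) - 1) * (p - 1) → (p : R) ^ r • E j = 0 from
    fun j hj => H j.toNat j hj (by omega)
  intro n
  induction n with
  | zero => intro j _ hj _; rw [hE j (by simpa using hj), smul_zero]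
  | succ n ihn =>
    intro j hjd hjn hj
    obtain hr | ⟨r, rfl⟩ : r ≤ 1 ∨ ∃ s, r = s + 2 := by
      rcases Nat.lt_or_ge r 2 with h | h
      · exact .inl (by omega)
      · exact .inr ⟨r - 2, by omega⟩
    · rw [hE j (by interval_cases r <;> push_cast at hj <;> linarith), smul_zero]
    push_cast at hj hjn
    have h := (hrel j hjd).three_term hp ⊥ r
      (fun i hi => by
        rw [Submodule.mem_bot]
        exact ihn i (by omega) (by omega) (by push_cast; linarith))
      (fun i hi => by
        rw [Submodule.mem_bot]
        exact ih (r + 1) (by omega) i (by linarith) (by push_cast; linarith))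
    rw [Submodule.mem_bot, ih (r + 1) (by omega) _ (by linarith) (by push_cast; linarith),
      ih r (by omega) _ (by nlinarith) (by nlinarith)] at h
    simpa using h

theorem pow_smul_eq_neg_one_pow (hp : p.Prime) (hE : ∀ j ≤ 0, E j = 0)
    (hrel : ∀ j ≤ d, SeriesRelation R p E j) (m : ℕ) (hm : (m : ℤ) * (p - 1) + 1 ≤ d) :
    (p : R) ^ (m + 1) • E (m * (p - 1) + 1) = (-1 : R) ^ m • (p : R) • E 1 := by
  have hp2 : (2 : ℤ) ≤ p := by exact_mod_cast hp.two_le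
  induction m with
  | zero => simp
  | succ m ih =>
    push_cast at hm
    have h := (hrel (((m + 1 : ℕ) : ℤ) * (p - 1) + 1) (by push_cast; linarith)).three_term hp ⊥ m
      (fun i hi => by
        push_cast at hi
        rw [Submodule.mem_bot]
        exact pow_smul_eq_zero hp hE hrel _ i (by linarith) (by push_cast; linarith))
      (fun i hi => by
        push_cast at hi
        rw [Submodule.mem_bot]
        exact pow_smul_eq_zero hp hE hrel _ i (by linarith) (by push_cast; linarith))
    have h0 : (p : R) ^ m • E (((m + 1 : ℕ) : ℤ) * (p - 1) + 1 - (p ^ 2 - 1)) = 0 :=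
      pow_smul_eq_zero hp hE hrel _ _ (by push_cast; nlinarith) (by push_cast; nlinarith)
    rw [Submodule.mem_bot, h0, add_zero,
      show ((m + 1 : ℕ) : ℤ) * (p - 1) + 1 - (p - 1) = m * (p - 1) + 1 by push_cast; ring,
      ih (by linarith)] at h
    rw [eq_neg_of_add_eq_zero_left h]
    module

/-- Modulo `p ^ (k + 1)`, the terms of the sequence lie on the branch `p = -x ^ (p (p - 1))` of
the Newton polygon of `[p ^ 2](x) / x`: up to index `p r (p - 1)` they are killed by `p ^ r`.
The bound `d` on the indices used as witnesses is kept track of. -/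
theorem pow_smul_mem (hp : p.Prime) (hE : ∀ j ≤ 0, E j = 0)
    (hrel : ∀ j ≤ d, SeriesRelation R p E j) (k : ℕ) {r : ℕ} (hr : r ≤ k + 1) {j : ℤ}
    (hj : j ≤ p * r * (p - 1)) (hjd : j + (k + 1 - r) * (p - 1) ≤ d) :
    (p : R) ^ r • E j ∈ (p : R) ^ (k + 1) • initialSpan R E d := by
  have hp2 : (2 : ℤ) ≤ p := by exact_mod_cast hp.two_le
  have hpg : 2 * ((p : ℤ) - 1) ≤ p * (p - 1) := by nlinarith
  -- The three-term relation leads from `(r, j)` to `(r + 1, j + g)`, `(r, j')` with `j' < j`, and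
  -- `(r - 1, j - p g)`, where `g = p - 1`; the weight `2 j - 3 g r` decreases in each case.
  obtain ⟨n, hn⟩ : ∃ n : ℕ, 2 * j + 3 * (p - 1) * (k + 1 - r) ≤ n :=
    ⟨(2 * j + 3 * ((p : ℤ) - 1) * (k + 1 - r)).toNat, Int.self_le_toNat _⟩
  induction n using Nat.strong_induction_on generalizing r j with
  | _ n ih =>
  have hrk : (r : ℤ) ≤ k + 1 := by exact_mod_cast hr
  rcases le_or_gt j 0 with hj0 | hj0
  · rw [hE j hj0, smul_zero]
    exact Submodule.zero_mem _
  have hw : 0 ≤ 3 * ((p : ℤ) - 1) * (k + 1 - r) := mul_nonneg (by linarith) (by linarith)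
  rcases eq_or_lt_of_le hr with rfl | hr'
  · refine Submodule.smul_mem_pointwise_smul _ _ _ (mem_initialSpan E ?_)
    push_cast at hjd
    linarith
  obtain _ | ρ := r
  · simp at hj
    omega
  push_cast at hj hjd hn hrk hw
  have hρk : (ρ : ℤ) + 1 ≤ k := by exact_mod_cast Nat.lt_succ_iff.1 hr'
  have hkρ : 0 ≤ ((k : ℤ) - (ρ + 1)) * (p - 1) := mul_nonneg (by linarith) (by linarith)
  have key : ∀ (s : ℕ) (i : ℤ), s ≤ k + 1 → i ≤ p * s * (p - 1) →
      i + (k + 1 - s) * (p - 1) ≤ d →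
      2 * i + 3 * (p - 1) * (k + 1 - s) < 2 * j + 3 * ((p : ℤ) - 1) * (k + 1 - (ρ + 1)) →
      (p : R) ^ s • E i ∈ (p : R) ^ (k + 1) • initialSpan R E d := by
    intro s i hs hi hid hlt
    refine ih (n - 1) (by omega) hs hi hid ?_
    omega
  have h2 : ∀ i ≤ j + (p - 1), (p : R) ^ (ρ + 2) • E i ∈
      (p : R) ^ (k + 1) • initialSpan R E d := fun i hi =>
    key (ρ + 2) i (by omega) (by push_cast; linarith) (by push_cast; linarith)
      (by push_cast; linarith)
  have h := (hrel (j + (p - 1)) (by linarith)).three_term hp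
    ((p : R) ^ (k + 1) • initialSpan R E d) ρ
    (fun i hi => h2 i hi.le)
    (fun i hi => key (ρ + 1) i (by omega) (by push_cast; linarith) (by push_cast; linarith)
      (by push_cast; linarith))
  have h3 : (p : R) ^ ρ • E (j + (p - 1) - (p ^ 2 - 1)) ∈
      (p : R) ^ (k + 1) • initialSpan R E d :=
    key ρ _ (by omega) (by nlinarith) (by nlinarith) (by nlinarith)
  rw [Submodule.add_mem_iff_left _ h3, Submodule.add_mem_iff_right _ (h2 _ le_rfl),
    add_sub_cancel_right] at h
  exact h

/-- In the first index not covered by `pow_smul_mem`, multiplication by `p ^ r` gives the bottom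
term `E 1` up to sign. -/
theorem pow_smul_sub_mem (hp : p.Prime) (hE : ∀ j ≤ 0, E j = 0)
    (hrel : ∀ j ≤ d, SeriesRelation R p E j) (k : ℕ)
    (hd : (p : ℤ) * k * (p - 1) + 1 + (p - 1) ≤ d) {r : ℕ} (hr : r ≤ k) :
    (p : R) ^ r • E (p * r * (p - 1) + 1) - (-1 : R) ^ r • E 1 ∈
      (p : R) ^ (k + 1) • initialSpan R E d := by
  have hp2 : (2 : ℤ) ≤ p := by exact_mod_cast hp.two_le
  have hpg : 2 * ((p : ℤ) - 1) ≤ p * (p - 1) := by nlinarith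
  induction r with
  | zero => simp
  | succ r ih =>
    have hrk : (r : ℤ) + 1 ≤ k := by exact_mod_cast hr
    -- Every pair of indices met below is within the range of `pow_smul_mem`.
    have hb : (p : ℤ) * (r + 1) * (p - 1) + 1 + (p - 1) + (k - (r + 1)) * (p - 1) ≤ d := by
      have : 0 ≤ ((k : ℤ) - (r + 1)) * ((p - 1) * (p - 1)) :=
        mul_nonneg (by linarith) (by nlinarith)
      nlinarith
    have hkr : 0 ≤ ((k : ℤ) - (r + 1)) * (p - 1) := mul_nonneg (by linarith) (by linarith)
    have h2 : ∀ i ≤ (p : ℤ) * (r + 1) * (p - 1) + 1 + (p - 1), (p : R) ^ (r + 2) • E i ∈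
        (p : R) ^ (k + 1) • initialSpan R E d := fun i hi =>
      pow_smul_mem hp hE hrel k (by omega) (by push_cast; linarith) (by push_cast; linarith)
    have h := (hrel ((p : ℤ) * (r + 1) * (p - 1) + 1 + (p - 1)) (by linarith)).three_term hp
      ((p : R) ^ (k + 1) • initialSpan R E d) r
      (fun i hi => h2 i hi.le)
      (fun i hi => pow_smul_mem hp hE hrel k (by omega) (by push_cast; linarith)
        (by push_cast; linarith))
    rw [add_assoc, Submodule.add_mem_iff_right _ (h2 _ le_rfl), add_sub_cancel_right,
      show (p : ℤ) * (r + 1) * (p - 1) + 1 + (p - 1) - (p ^ 2 - 1) = p * r * (p - 1) + 1 by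
        ring] at h
    have h' := Submodule.sub_mem _ h (ih (by omega))
    push_cast
    convert h' using 1
    module

/-- There is an element `w` with leading term `p • E J`, where
`J = (p k + 1) (p - 1) + 1`, which is killed by `p ^ (k + 1)` and for which `p ^ k • w` is the
bottom term `E 1`, up to sign and multiples of `p ^ (k + 1)`. -/
theorem exists_torsion_lift (hp : p.Prime) (hE : ∀ j ≤ 0, E j = 0) {k : ℕ} (hk : 1 ≤ k)
    {J : ℤ} (hJ : J = (p * k + 1) * (p - 1) + 1)
    (hrel : ∀ j ≤ J, SeriesRelation R p E j) :
    ∃ m ∈ initialSpan R E (J - 1), ∃ z ∈ initialSpan R E J,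
      (p : R) ^ (k + 1) • ((p : R) • E J + m) = 0 ∧
      (p : R) ^ k • ((p : R) • E J + m) = (-1 : R) ^ k • E 1 + (p : R) ^ (k + 1) • z := by
  have hp2 : (2 : ℤ) ≤ p := by exact_mod_cast hp.two_le
  have hk1 : (1 : ℤ) ≤ k := by exact_mod_cast hk
  have hJ' : (p : ℤ) * k * (p - 1) + 1 + (p - 1) = J := by rw [hJ]; ring
  have hpg : 2 * ((p : ℤ) - 1) ≤ p * (p - 1) := by nlinarith
  set b : ℤ := p * k * (p - 1) with hb
  set S : Submodule R A := (p : R) • initialSpan R E (J - 1) ⊔ initialSpan R E b with hS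
  have hrelb : ∀ j ≤ b, SeriesRelation R p E j := fun j hj => hrel j (by linarith)
  have h := (hrel J le_rfl).three_term hp ((p : R) ^ (k + 1) • S) k
    (fun i hi => by
      rw [pow_succ (p : R) (k + 1), mul_smul]
      exact Submodule.smul_mem_pointwise_smul _ _ _ (Submodule.mem_sup_left
        (Submodule.smul_mem_pointwise_smul _ _ _ (mem_initialSpan E (by omega)))))
    (fun i hi => Submodule.smul_mem_pointwise_smul _ _ _ (Submodule.mem_sup_right
      (mem_initialSpan E (by omega))))
  have hlast : (p : R) ^ k • E (J - (p ^ 2 - 1)) ∈ (p : R) ^ (k + 1) • S := by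
    have hidx : J - (p ^ 2 - 1) = b - p * (p - 1) + 1 := by rw [← hJ']; ring
    have := pow_smul_mem hp hE hrelb k (r := k) (j := J - (p ^ 2 - 1)) (by omega)
      (by rw [hidx]; nlinarith) (by rw [hidx]; linarith)
    rw [Submodule.mem_smul_pointwise_iff_exists] at this
    obtain ⟨x, hx, hx'⟩ := this
    rw [← hx']
    exact Submodule.smul_mem_pointwise_smul _ _ _ (Submodule.mem_sup_right hx)
  rw [Submodule.add_mem_iff_left _ hlast, Submodule.mem_smul_pointwise_iff_exists] at h
  obtain ⟨y, hy, hyE⟩ := h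
  obtain ⟨y₁, hy₁, y₂, hy₂, rfl⟩ := Submodule.mem_sup.1 hy
  rw [Submodule.mem_smul_pointwise_iff_exists] at hy₁
  obtain ⟨y₁, hy₁, rfl⟩ := hy₁
  have hmono : ∀ {c c' : ℤ}, c ≤ c' → initialSpan R E c ≤ initialSpan R E c' := fun hc =>
    Submodule.span_mono (Set.image_mono (Set.Iic_subset_Iic.2 hc))
  have hJb : J - (p - 1) = b + 1 := by rw [← hJ']; ring
  rw [hJb] at hyE
  have hE1 := pow_smul_sub_mem hp hE hrel k hJ'.le le_rfl
  rw [← hb, Submodule.mem_smul_pointwise_iff_exists] at hE1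
  obtain ⟨z₁, hz₁, hz₁E⟩ := hE1
  have hy₂' : (p : R) ^ k • y₂ ∈ (p : R) ^ (k + 1) • initialSpan R E J := by
    have : initialSpan R E b ≤ ((p : R) ^ (k + 1) • initialSpan R E J).comap
        (LinearMap.lsmul R A ((p : R) ^ k)) := by
      rw [initialSpan, Submodule.span_le]
      rintro _ ⟨i, hi, rfl⟩
      exact pow_smul_mem hp hE hrel k (by omega) hi (by
        have : i ≤ b := hi
        linarith)
    exact this hy₂
  rw [Submodule.mem_smul_pointwise_iff_exists] at hy₂'
  obtain ⟨z₂, hz₂, hz₂E⟩ := hy₂'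
  refine ⟨E (b + 1) - (p : R) • y₁ - y₂, ?_, E J + z₁ - y₁ - z₂, ?_, ?_, ?_⟩
  · exact Submodule.sub_mem _ (Submodule.sub_mem _ (mem_initialSpan E (by omega))
      (Submodule.smul_mem _ _ hy₁)) (hmono (by omega) hy₂)
  · exact Submodule.sub_mem _ (Submodule.sub_mem _ (Submodule.add_mem _ (mem_initialSpan E le_rfl)
      hz₁) (hmono (by omega) hy₁)) hz₂
  · linear_combination (norm := module) -hyE
  · linear_combination (norm := module) -hz₁E + hz₂E

end Sequences

/-! ### The `ku_*`-homology of `ℤ/p ^ n` -/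

variable {p : ℕ} [Fact p.Prime]

theorem alpha_of_nonpos {h : ℤ} (hh : h ≤ 0) : alpha p h = 0 :=
  dif_neg (by omega)

theorem e_of_nonpos (n : ℕ) {j : ℤ} (hj : j ≤ 0) : e p n j = 0 := by
  rw [e, alpha_of_nonpos hj, map_zero]

/-- The sequence of the generators `e_j`, each multiplied by the power of `v` which moves it to
the degree of `e_d`; for `j > d` the exponent is `0`, and these terms play no role. -/
noncomputable def degreeSeq (p : ℕ) [Fact p.Prime] (n : ℕ) (d j : ℤ) : KuHomology p n :=
  v p ^ (d - j).toNat • e p n j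

theorem degreeSeq_of_nonpos (n : ℕ) (d : ℤ) : ∀ j ≤ 0, degreeSeq p n d j = 0 := fun j hj => by
  rw [degreeSeq, e_of_nonpos n hj, smul_zero]

theorem degreeSeq_self (n : ℕ) (d : ℤ) : degreeSeq p n d d = e p n d := by
  simp [degreeSeq]

theorem seriesRelation_degreeSeq (d : ℤ) :
    ∀ j ≤ d, SeriesRelation (Ku p) p (degreeSeq p 2 d) j := by
  intro j hj
  rw [SeriesRelation]
  rcases le_or_gt j 0 with h0 | h0
  · exact Finset.sum_eq_zero fun t _ => by
      rw [degreeSeq_of_nonpos 2 d _ (by omega), smul_zero]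
  · have h := congrArg (v p ^ (d - j).toNat • ·) (sum_e_eq_zero p 2 j h0)
    simp only [smul_zero, Finset.smul_sum] at h
    rw [← h]
    refine Finset.sum_congr rfl fun t _ => ?_
    rw [degreeSeq, seriesCoeff, show (d - (j - t)).toNat = (d - j).toNat + t by omega, pow_add]
    module

theorem initialSpan_degreeSeq_le (n : ℕ) (d c : ℤ) :
    initialSpan (Ku p) (degreeSeq p n d) c ≤
      Submodule.span (Ku p) (e p n '' Set.Icc 1 c) := by
  rw [initialSpan, Submodule.span_le]
  rintro _ ⟨j, hj, rfl⟩
  rcases le_or_gt j 0 with h0 | h0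
  · rw [degreeSeq_of_nonpos n d j h0]
    exact Submodule.zero_mem _
  · exact Submodule.smul_mem _ _ (Submodule.subset_span ⟨j, ⟨h0, hj⟩, rfl⟩)

/-! ### The `[p ^ n]`-series on the free module -/

theorem seriesMap_alpha (n : ℕ) (i : ℤ) :
    seriesMap p n (alpha p i) =
      ∑ t ∈ Finset.range (p ^ n), seriesCoeff p n t • alpha p (i - t) := by
  rcases le_or_gt i 0 with h0 | h0
  · rw [alpha_of_nonpos h0, map_zero]
    exact (Finset.sum_eq_zero fun t _ => by rw [alpha_of_nonpos (by omega), smul_zero]).symm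
  · have h1 : ((i.toNat : ℕ) : ℤ) = i := Int.toNat_of_nonneg (by omega)
    conv_lhs => rw [alpha, dif_pos h0, seriesMap, Finsupp.linearCombination_single, one_smul]
    simp only [Nat.toPNat, PNat.mk_coe, h1]

/-- Below `α_p` the `[p ^ n]`-series acts as `p ^ n` times an invertible operator. -/
theorem pow_smul_alpha_mem_map (n : ℕ) {i : ℤ} (hi : i < p) :
    (p : Ku p) ^ n • alpha p i ∈
      (Submodule.span (Ku p) (alpha p '' Set.Ico 1 (p : ℤ))).map (seriesMap p n) := by
  have hp : p.Prime := Fact.out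
  set G := (Submodule.span (Ku p) (alpha p '' Set.Ico 1 (p : ℤ))).map (seriesMap p n)
  obtain ⟨N, hN⟩ : ∃ N : ℕ, i ≤ N := ⟨i.toNat, Int.self_le_toNat i⟩
  induction N using Nat.strong_induction_on generalizing i with
  | _ N ih =>
  rcases le_or_gt i 0 with h0 | h0
  · rw [alpha_of_nonpos h0, smul_zero]
    exact Submodule.zero_mem _
  have hmem : seriesMap p n (alpha p i) ∈ G :=
    Submodule.mem_map_of_mem (Submodule.subset_span ⟨i, ⟨h0, hi⟩, rfl⟩)
  have h00 : 0 ∈ Finset.range (p ^ n) := Finset.mem_range.2 (pow_pos hp.pos n)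
  rw [seriesMap_alpha, ← Finset.add_sum_erase _ _ h00, Submodule.add_mem_iff_left] at hmem
  · simpa [seriesCoeff] using hmem
  · refine Submodule.sum_mem _ fun t ht => ?_
    have ht0 : t ≠ 0 := Finset.ne_of_mem_erase ht
    rcases le_or_gt i t with hit | hit
    · rw [alpha_of_nonpos (by omega), smul_zero]
      exact Submodule.zero_mem _
    · have hdvd : ¬ p ∣ t + 1 := Nat.not_dvd_of_pos_of_lt (by omega) (by omega)
      obtain ⟨m, hm⟩ := pow_dvd_choose_pow hp n hdvd
      have : seriesCoeff p n t • alpha p (i - t) =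
          ((m : Ku p) * v p ^ t) • (p : Ku p) ^ n • alpha p (i - t) := by
        rw [seriesCoeff, hm]; push_cast; module
      rw [this]
      exact Submodule.smul_mem _ _ (ih (N - 1) (by omega) (by omega) (by omega))

/-- Up to a change of `α_p` by lower generators, the `[p ^ (n + 1)]`-series has only two terms
on `α_p`. -/
theorem exists_seriesMap_two_term (n : ℕ) :
    ∃ γ ∈ Submodule.span (Ku p) (alpha p '' Set.Ico 1 (p : ℤ)),
      seriesMap p (n + 1) (alpha p p + γ) =
        (p : Ku p) ^ (n + 1) • alpha p p + ((p : Ku p) ^ n * v p ^ (p - 1)) • alpha p 1 := by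
  have hp : p.Prime := Fact.out
  have hp2 := hp.two_le
  set G := (Submodule.span (Ku p) (alpha p '' Set.Ico 1 (p : ℤ))).map (seriesMap p (n + 1))
  suffices h : seriesMap p (n + 1) (alpha p p) - ((p : Ku p) ^ (n + 1) • alpha p p +
      ((p : Ku p) ^ n * v p ^ (p - 1)) • alpha p 1) ∈ G by
    obtain ⟨γ, hγ, hγE⟩ := h
    refine ⟨-γ, Submodule.neg_mem _ hγ, ?_⟩
    rw [map_add, map_neg, hγE]
    abel
  have hpn : p ≤ p ^ (n + 1) := Nat.le_self_pow (by omega) p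
  have h0 : 0 ∈ Finset.range (p ^ (n + 1)) := Finset.mem_range.2 (by omega)
  have h1 : p - 1 ∈ (Finset.range (p ^ (n + 1))).erase 0 :=
    Finset.mem_erase.2 ⟨by omega, Finset.mem_range.2 (by omega)⟩
  rw [seriesMap_alpha, ← Finset.add_sum_erase _ _ h0, ← Finset.add_sum_erase _ _ h1]
  set s := ∑ t ∈ ((Finset.range (p ^ (n + 1))).erase 0).erase (p - 1),
    seriesCoeff p (n + 1) t • alpha p ((p : ℤ) - t) with hs
  have hsG : s ∈ G := by
    refine Submodule.sum_mem _ fun t ht => ?_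
    have ht1 : t ≠ p - 1 := Finset.ne_of_mem_erase ht
    have ht0 : t ≠ 0 := Finset.ne_of_mem_erase (Finset.mem_of_mem_erase ht)
    rcases le_or_gt p t with hit | hit
    · rw [alpha_of_nonpos (by omega), smul_zero]
      exact Submodule.zero_mem _
    · have hdvd : ¬ p ∣ t + 1 := Nat.not_dvd_of_pos_of_lt (by omega) (by omega)
      obtain ⟨m, hm⟩ := pow_dvd_choose_pow hp (n + 1) hdvd
      have : seriesCoeff p (n + 1) t • alpha p ((p : ℤ) - t) =
          ((m : Ku p) * v p ^ t) • (p : Ku p) ^ (n + 1) • alpha p ((p : ℤ) - t) := by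
        rw [seriesCoeff, hm]; push_cast; module
      rw [this]
      exact Submodule.smul_mem _ _ (pow_smul_alpha_mem_map (n + 1) (by omega))
  obtain ⟨c, hc⟩ := exists_choose_pow_succ_self hp n
  have hc' : seriesCoeff p (n + 1) (p - 1) =
      (p : Ku p) ^ n * (1 + p * (c : Ku p)) * v p ^ (p - 1) := by
    rw [seriesCoeff, Nat.sub_add_cancel (by omega)]
    have := congrArg (Int.cast : ℤ → Ku p) hc
    push_cast at this
    rw [this]
  have hc0 : seriesCoeff p (n + 1) 0 = (p : Ku p) ^ (n + 1) := by simp [seriesCoeff]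
  have hp1 : (p : ℤ) - (p - 1 : ℕ) = 1 := by omega
  rw [hc', hc0, hp1, Nat.cast_zero, sub_zero]
  have h1G := Submodule.add_mem _ hsG (Submodule.smul_mem G ((c : Ku p) * v p ^ (p - 1))
    (pow_smul_alpha_mem_map (n + 1) (i := 1) (by omega)))
  convert h1G using 1
  module

/-! ### The boundary -/

theorem boundary_tmul (n m : ℕ) (x : F p) (y : KuHomology p n) :
    boundary p n m (x ⊗ₜ y) = seriesMap p m x ⊗ₜ y :=
  LinearMap.rTensor_tmul _ _ _ _

theorem seriesMap_alpha_one (n : ℕ) : seriesMap p n (alpha p 1) = (p : Ku p) ^ n • alpha p 1 := by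
  have hp : p.Prime := Fact.out
  have h00 : 0 ∈ Finset.range (p ^ n) := Finset.mem_range.2 (pow_pos hp.pos n)
  rw [seriesMap_alpha, ← Finset.add_sum_erase _ _ h00, Finset.sum_eq_zero, add_zero]
  · simp [seriesCoeff]
  · intro t ht
    have := Finset.ne_of_mem_erase ht
    rw [alpha_of_nonpos (by omega), smul_zero]

theorem tmul_mem_of_mem_span {n : ℕ} {S : Submodule (Ku p) (Term p n)} {I K : Set ℤ} {x : F p}
    {y : KuHomology p n} (hx : x ∈ Submodule.span (Ku p) (alpha p '' I))
    (hy : y ∈ Submodule.span (Ku p) (e p n '' K))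
    (h : ∀ i ∈ I, ∀ j ∈ K, gen p n i j ∈ S) : x ⊗ₜ y ∈ S := by
  have hle : Submodule.map₂ (TensorProduct.mk (Ku p) (F p) (KuHomology p n))
      (Submodule.span (Ku p) (alpha p '' I)) (Submodule.span (Ku p) (e p n '' K)) ≤ S := by
    rw [Submodule.map₂_span_span, Submodule.span_le]
    rintro _ ⟨_, ⟨i, hi, rfl⟩, _, ⟨j, hj, rfl⟩, rfl⟩
    exact h i hi j hj
  exact hle (Submodule.apply_mem_map₂ _ hx hy)

theorem gen_mem_lowerTerms (n k : ℕ) {i j a b : ℤ} (hi : 1 ≤ i) (hj : 1 ≤ j) (hia : i ≤ a)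
    (hjb : j ≤ b) (hne : i < a ∨ j < b) : gen p n i j ∈ lowerTerms p n k a b := by
  refine Submodule.subset_span ⟨i, j, hi, hj, ?_, rfl⟩
  have h1 : (0 : ℤ) < (p : ℤ) ^ (k + 1) + 1 := by positivity
  have h2 : (0 : ℤ) < (p : ℤ) ^ k + 1 := by positivity
  rw [filtrationDegree, filtrationDegree]
  rcases hne with h | h <;> nlinarith

theorem boundary_gen_one (k : ℕ) :
    boundary p 2 (k + 1) (gen p 2 1 (k * (p - 1) + 1)) =
      ((-1 : Ku p) ^ k * (p * v p ^ (k * (p - 1)))) • gen p 2 1 1 := by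
  have hp : p.Prime := Fact.out
  set d : ℤ := k * (p - 1) + 1 with hd
  have h := pow_smul_eq_neg_one_pow hp (degreeSeq_of_nonpos 2 d) (seriesRelation_degreeSeq (p := p) d)
    k le_rfl
  have hexp : (d - 1).toNat = k * (p - 1) := by
    have : d - 1 = ((k * (p - 1) : ℕ) : ℤ) := by
      push_cast [Nat.cast_sub hp.one_le]; rw [hd]; ring
    rw [this, Int.toNat_natCast]
  rw [← hd, degreeSeq_self, degreeSeq, hexp] at h
  rw [gen, boundary_tmul, seriesMap_alpha_one, TensorProduct.smul_tmul, h, gen,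
    ← TensorProduct.tmul_smul]
  congr 1
  module

theorem exists_boundary_eq (k : ℕ) (hk : 1 ≤ k) :
    ∃ low ∈ lowerTerms p 2 k p (((p : ℤ) * k + 1) * (p - 1) + 1),
      boundary p 2 (k + 1) ((p : Ku p) • gen p 2 p (((p : ℤ) * k + 1) * (p - 1) + 1) + low) =
        ((-1 : Ku p) ^ k * v p ^ ((k * p + 2) * (p - 1))) • gen p 2 1 1 := by
  have hp : p.Prime := Fact.out
  have hp2 : (2 : ℤ) ≤ p := by exact_mod_cast hp.two_le
  set J : ℤ := ((p : ℤ) * k + 1) * (p - 1) + 1 with hJ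
  obtain ⟨m, hm, z, hz, hw0, hw1⟩ := exists_torsion_lift hp (degreeSeq_of_nonpos 2 J) hk hJ
    (seriesRelation_degreeSeq (p := p) J)
  obtain ⟨γ, hγ, hβ⟩ := exists_seriesMap_two_term (p := p) k
  rw [degreeSeq_self] at hw0 hw1
  have hm' := initialSpan_degreeSeq_le _ _ _ hm
  have hz' := initialSpan_degreeSeq_le _ _ _ hz
  have hJ1 : 1 ≤ J := by
    have : 0 ≤ ((p : ℤ) * k + 1) * (p - 1) := mul_nonneg (by positivity) (by linarith)
    linarith
  set w : KuHomology p 2 := (p : Ku p) • e p 2 J + m with hw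
  have hw' : w ∈ Submodule.span (Ku p) (e p 2 '' Set.Icc 1 J) :=
    Submodule.add_mem _
      (Submodule.smul_mem _ _ (Submodule.subset_span ⟨J, ⟨hJ1, le_rfl⟩, rfl⟩))
      (Submodule.span_mono (Set.image_mono (Set.Icc_subset_Icc_right (by omega))) hm')
  have hexp : (J - 1).toNat + (p - 1) = (k * p + 2) * (p - 1) := by
    have : J - 1 = (((k * p + 1) * (p - 1) : ℕ) : ℤ) := by
      push_cast [Nat.cast_sub hp.one_le]; rw [hJ]; ring
    rw [this, Int.toNat_natCast]
    ring
  have hα : ∀ i : ℤ, alpha p i ∈ Submodule.span (Ku p) (alpha p '' ({i} : Set ℤ)) := fun i =>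
    Submodule.subset_span ⟨i, rfl, rfl⟩
  have hnz : -(v p ^ (p - 1) • z) ∈ Submodule.span (Ku p) (e p 2 '' Set.Icc 1 J) :=
    Submodule.neg_mem _ (Submodule.smul_mem _ _ hz')
  -- The preimage is `(α_p + γ) ⊗ w - α_1 ⊗ v ^ (p - 1) z`.
  refine ⟨alpha p p ⊗ₜ m + (γ ⊗ₜ w + alpha p 1 ⊗ₜ (-(v p ^ (p - 1) • z))), ?_, ?_⟩
  · refine Submodule.add_mem _ ?_ (Submodule.add_mem _ ?_ ?_)
    · refine tmul_mem_of_mem_span (hα p) hm' fun i hi j hj => ?_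
      rw [Set.mem_singleton_iff] at hi
      have := hj.2
      exact gen_mem_lowerTerms 2 k (by omega) hj.1 hi.le (by omega) (by omega)
    · exact tmul_mem_of_mem_span hγ hw' fun i hi j hj =>
        gen_mem_lowerTerms 2 k hi.1 hj.1 hi.2.le hj.2 (.inl hi.2)
    · refine tmul_mem_of_mem_span (hα 1) hnz fun i hi j hj => ?_
      rw [Set.mem_singleton_iff] at hi
      exact gen_mem_lowerTerms 2 k (by omega) hj.1 (by omega) hj.2 (by omega)
  · have hsplit : (p : Ku p) • gen p 2 p J +
        (alpha p p ⊗ₜ m + (γ ⊗ₜ w + alpha p 1 ⊗ₜ (-(v p ^ (p - 1) • z)))) =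
        (alpha p p + γ) ⊗ₜ w + alpha p 1 ⊗ₜ (-(v p ^ (p - 1) • z)) := by
      rw [TensorProduct.add_tmul, hw, TensorProduct.tmul_add (alpha p p), TensorProduct.tmul_smul,
        gen, add_assoc, add_assoc]
    have hbottom : ((p : Ku p) ^ k * v p ^ (p - 1)) • w +
        (p : Ku p) ^ (k + 1) • -(v p ^ (p - 1) • z) =
        ((-1 : Ku p) ^ k * v p ^ ((k * p + 2) * (p - 1))) • e p 2 1 := by
      rw [degreeSeq] at hw1
      rw [mul_comm, mul_smul, hw1, ← hexp, pow_add]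
      module
    rw [hsplit, map_add, boundary_tmul, boundary_tmul, hβ, seriesMap_alpha_one,
      TensorProduct.add_tmul, TensorProduct.smul_tmul, hw0, TensorProduct.tmul_zero, zero_add,
      TensorProduct.smul_tmul, TensorProduct.smul_tmul, ← TensorProduct.tmul_add, hbottom,
      TensorProduct.tmul_smul, gen]

end KuToral

theorem mainTheorem2 (p : ℕ) [Fact p.Prime] (k : ℕ) (hk : 2 ≤ k) :
    (∃ u : (KuToral.Ku p)ˣ,
      KuToral.boundary p 2 (k + 1) (KuToral.gen p 2 1 ((k : ℤ) * KuToral.g p 1 + 1)) =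
        ((u : KuToral.Ku p) * ((p : KuToral.Ku p) * KuToral.v p ^ (k * KuToral.g p 1))) •
          KuToral.gen p 2 1 1) ∧
    (∃ low ∈ KuToral.lowerTerms p 2 k (p : ℤ) (((p : ℤ) * k + 1) * KuToral.g p 1 + 1),
      ∃ u : (KuToral.Ku p)ˣ,
        KuToral.boundary p 2 (k + 1)
            ((p : KuToral.Ku p) •
              KuToral.gen p 2 (p : ℤ) (((p : ℤ) * k + 1) * KuToral.g p 1 + 1) + low) =
          ((u : KuToral.Ku p) * KuToral.v p ^ ((k * p + 2) * KuToral.g p 1)) •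
            KuToral.gen p 2 1 1) := by
  have hp : p.Prime := Fact.out
  have hg : KuToral.g p 1 = p - 1 := by rw [KuToral.g, pow_one]
  have hgz : (KuToral.g p 1 : ℤ) = p - 1 := by rw [hg, Nat.cast_sub hp.one_le, Nat.cast_one]
  rw [hgz, hg]
  have hu : (((-1 : (KuToral.Ku p)ˣ) ^ k : (KuToral.Ku p)ˣ) : KuToral.Ku p) = (-1) ^ k := by
    simp
  obtain ⟨low, hlow, h⟩ := KuToral.exists_boundary_eq (p := p) k (by omega)
  refine ⟨⟨(-1) ^ k, ?_⟩, low, hlow, (-1) ^ k, ?_⟩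
  · rw [hu]
    exact KuToral.boundary_gen_one k
  · rw [hu]
    exact h
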